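/- Let $\mathcal A,\mathcal B,\mathcal C$ be abelian categories with enough projectives and enough injectives. A recollement $(\mathcal A,\mathcal B,\mathcal C)$ consists of functors $i:\mathcal A\to\mathcal B$, $q,p:\mathcal B\to\mathcal A$, $e:\mathcal B\to\mathcal C$ and $l,r:\mathcal C\to\mathcal B$ such that $(q,i)$, $(i,p)$, $(l,e)$, $(e,r)$ are adjoint pairs, $i,l,r$ are fully faithful, and the essential image of $i$ is the kernel of $e$ (so $e$ is exact). Put $$\mathrm{pgld}_{\mathcal B}\mathcal A=\sup\{\mathrm{pd}_{\mathcal B}\,i(A)\mid A\in\mathcal A\},\qquad \mathrm{igld}_{\mathcal B}\mathcal A=\sup\{\mathrm{id}_{\mathcal B}\,i(A)\mid A\in\mathcal A\},$$ where zero objects have projective and injective dimension $0$. A functor $E:\mathcal B\to\mathcal C$ is an eventually homological isomorphism if there is a positive integer $t$ such that for all $n>t$ and all objects $X,Y$ of $\mathcal B$ there is some group isomorphism $\mathrm{Ext}^n_{\mathcal B}(X,Y)\simeq\mathrm{Ext}^n_{\mathcal C}(E(X),E(Y))$ (not necessarily induced by $E$); if $s$ is the least such $t$, then $E$ is called an $s$-eventually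 homological isomorphism. **Proposition.** Let $(\mathcal A,\mathcal B,\mathcal C)$ be a recollement. Assume that every object of $\mathcal A$ has finite length and that every object of $\mathcal B$ has a projective cover. The following are equivalent: 1. There is an integer $t$ such that for all objects $X,Y$ of $\mathcal B$ and all $j>t$ the map $e^j_{X,Y}:\mathrm{Ext}^j_{\mathcal B}(X,Y)\to\mathrm{Ext}^j_{\mathcal C}(e(X),e(Y))$ induced by $e$ is an isomorphism. 2. The functor $e$ is an eventually homological isomorphism. 3. $\mathrm{igld}_{\mathcal B}\mathcal A<\infty$ and $\sup\{\mathrm{pd}_{\mathcal C}\,e(P)\mid P\in\mathcal B\text{ projective}\}<\infty$. 4. $\mathrm{pgld}_{\mathcal B}\mathcal A<\infty$ and $\sup\{\mathrm{id}_{\mathcal C}\,e(I)\mid I\in\mathcal B\text{ injective}\}<\infty$. Moreover, if $e$ is an $s$-eventually homological isomorphism, then each of the four dimensions in (3) and (4) is at most $s$. Finally, the map $e^j_{X,Y}$ is an isomorphism for all $X,Y$ in $\mathcal B$ and all $$j>\mathrm{igld}_{\mathcal B}\mathcal A+\sup\{\mathrm{pd}_{\mathcal C}\,e(P)\mid P\in\mathcal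 B\text{ projective}\}+1,$$ and also for all $X,Y$ in $\mathcal B$ and all $$j>\mathrm{pgld}_{\mathcal B}\mathcal A+\sup\{\mathrm{id}_{\mathcal C}\,e(I)\mid I\in\mathcal B\text{ injective}\}+1.$$ -/

import Mathlib

open CategoryTheory CategoryTheory.Limits CategoryTheory.Abelian

universe w₂ w₃ v v₁ v₂ v₃ u u₁ u₂ u₃

/-- A recollement situation `(𝒜, ℬ, 𝒞)` of abelian categories: adjoint triples
`q ⊣ i ⊣ p` and `l ⊣ e ⊣ r` with `i`, `l`, `r` fully faithful, such that the essential image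
of `i` is the kernel of `e`. (Additivity of the functors is automatic, as they are adjoints.) -/
structure AbelianRecollement
    (𝒜 : Type u₁) [Category.{v₁} 𝒜] [Abelian 𝒜]
    (ℬ : Type u₂) [Category.{v₂} ℬ] [Abelian ℬ]
    (𝒞 : Type u₃) [Category.{v₃} 𝒞] [Abelian 𝒞] where
  /-- the inclusion functor -/
  i : 𝒜 ⥤ ℬ
  /-- the left adjoint of the inclusion -/
  q : ℬ ⥤ 𝒜
  /-- the right adjoint of the inclusion -/
  p : ℬ ⥤ 𝒜
  /-- the quotient functor -/
  e : ℬ ⥤ 𝒞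
  /-- the left adjoint of the quotient functor -/
  l : 𝒞 ⥤ ℬ
  /-- the right adjoint of the quotient functor -/
  r : 𝒞 ⥤ ℬ
  adj_le : l ⊣ e
  adj_er : e ⊣ r
  adj_qi : q ⊣ i
  adj_ip : i ⊣ p
  i_fullyFaithful : i.FullyFaithful
  l_fullyFaithful : l.FullyFaithful
  r_fullyFaithful : r.FullyFaithful
  essImage_i_iff : ∀ X : ℬ, i.essImage X ↔ IsZero (e.obj X)

/-- An object has finite length if it is filtered in finitely many steps with simple
subquotients. -/
inductive HasFiniteLength {𝒜 : Type u} [Category.{v} 𝒜] [Abelian 𝒜] : 𝒜 → Prop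
  | of_isZero {X : 𝒜} (hX : IsZero X) : HasFiniteLength X
  | of_shortExact {S : ShortComplex 𝒜} (hS : S.ShortExact) (h₁ : HasFiniteLength S.X₁)
      (h₃ : Simple S.X₃) : HasFiniteLength S.X₂

/-- A finite length category: every object has finite length. -/
def IsFiniteLengthCategory (𝒜 : Type u) [Category.{v} 𝒜] [Abelian 𝒜] : Prop :=
  ∀ X : 𝒜, HasFiniteLength X

/-- `f : P ⟶ X` is a projective cover: `P` is projective and `f` is an essential epimorphism. -/
structure IsProjectiveCover {ℬ : Type u} [Category.{v} ℬ] {P X : ℬ} (f : P ⟶ X) : Prop where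
  projective : Projective P
  epi : Epi f
  essential : ∀ ⦃Y : ℬ⦄ (g : Y ⟶ P), Epi (g ≫ f) → Epi g

/-- Every object has a projective cover. -/
def HasProjectiveCovers (ℬ : Type u) [Category.{v} ℬ] : Prop :=
  ∀ X : ℬ, ∃ (P : ℬ) (f : P ⟶ X), IsProjectiveCover f

/-- The projective dimension as an extended natural number
(a zero object has projective dimension `0`). -/
noncomputable def projDim {ℬ : Type u} [Category.{v} ℬ] [Abelian ℬ] (X : ℬ) : ℕ∞ :=
  (projectiveDimension X).unbotD 0

/-- The injective dimension as an extended natural number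
(a zero object has injective dimension `0`). -/
noncomputable def injDim {ℬ : Type u} [Category.{v} ℬ] [Abelian ℬ] (X : ℬ) : ℕ∞ :=
  (injectiveDimension X).unbotD 0

/-- For all `n > t` and all objects `X`, `Y` there is some group isomorphism
`Extⁿ(X, Y) ≃ Extⁿ(E X, E Y)`; it need not be induced by `E`. -/
def HasExtIsosAbove {ℬ : Type u₂} [Category.{v₂} ℬ] [Abelian ℬ] [HasExt.{w₂} ℬ]
    {𝒞 : Type u₃} [Category.{v₃} 𝒞] [Abelian 𝒞] [HasExt.{w₃} 𝒞] (E : ℬ ⥤ 𝒞) (t : ℕ) : Prop :=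
  ∀ n : ℕ, t < n → ∀ X Y : ℬ,
    Nonempty (Ext.{w₂} X Y n ≃+ Ext.{w₃} (E.obj X) (E.obj Y) n)

/-- The functor `E` is an eventually homological isomorphism. -/
def IsEventuallyHomologicalIso {ℬ : Type u₂} [Category.{v₂} ℬ] [Abelian ℬ] [HasExt.{w₂} ℬ]
    {𝒞 : Type u₃} [Category.{v₃} 𝒞] [Abelian 𝒞] [HasExt.{w₃} 𝒞] (E : ℬ ⥤ 𝒞) : Prop :=
  ∃ t : ℕ, 0 < t ∧ HasExtIsosAbove.{w₂, w₃} E t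

/-- The functor `E` is an `s`-eventually homological isomorphism: `s` is the least positive
integer above which there are isomorphisms of extension groups. -/
def IsEventuallyHomologicalIsoOfDegree
    {ℬ : Type u₂} [Category.{v₂} ℬ] [Abelian ℬ] [HasExt.{w₂} ℬ]
    {𝒞 : Type u₃} [Category.{v₃} 𝒞] [Abelian 𝒞] [HasExt.{w₃} 𝒞] (E : ℬ ⥤ 𝒞) (s : ℕ) : Prop :=
  IsLeast {t : ℕ | 0 < t ∧ HasExtIsosAbove.{w₂, w₃} E t} s

namespace AbelianRecollement

variable {𝒜 : Type u₁} [Category.{v₁} 𝒜] [Abelian 𝒜]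
  {ℬ : Type u₂} [Category.{v₂} ℬ] [Abelian ℬ]
  {𝒞 : Type u₃} [Category.{v₃} 𝒞] [Abelian 𝒞]
  (R : AbelianRecollement 𝒜 ℬ 𝒞)

instance preservesFiniteLimits_e : PreservesFiniteLimits R.e := by
  have := R.adj_le.rightAdjoint_preservesLimits
  exact ⟨fun _ _ _ => inferInstance⟩

instance preservesFiniteColimits_e : PreservesFiniteColimits R.e := by
  have := R.adj_er.leftAdjoint_preservesColimits
  exact ⟨fun _ _ _ => inferInstance⟩

instance additive_e : R.e.Additive :=
  Functor.additive_of_preserves_binary_products R.e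

/-- The `𝒜`-relative projective global dimension of `ℬ`. -/
noncomputable def pgld : ℕ∞ := ⨆ A : 𝒜, projDim (R.i.obj A)

/-- The `𝒜`-relative injective global dimension of `ℬ`. -/
noncomputable def igld : ℕ∞ := ⨆ A : 𝒜, injDim (R.i.obj A)

/-- `sup {pd e(P) | P projective in ℬ}`. -/
noncomputable def supPdProj : ℕ∞ := ⨆ (P : ℬ) (_ : Projective P), projDim (R.e.obj P)

/-- `sup {id e(I) | I injective in ℬ}`. -/
noncomputable def supIdInj : ℕ∞ := ⨆ (I : ℬ) (_ : Injective I), injDim (R.e.obj I)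

end AbelianRecollement

/-! Every object killed by `e` lies in the essential image of `i`. The unit `Y ⟶ r (e Y)` becomes
invertible under `e`, so its kernel and cokernel are such objects. If `igld` is finite, it therefore
induces isomorphisms on `Ext X _` in high degrees, and `Y` may be replaced by `r (e Y)`. For `r Z`,
an injective embedding `Z ⟶ J` allows dimension shifting, since `r J` and `e (r J) ≅ J` are both
injective. When `Ext` from all `e P` to `Z` vanishes in positive degrees, `r` keeps the resulting
sequences exact and the comparison is bijective in all degrees (`mapExt_bijective_r`). A finite
bound on `pd e P` reduces to this case by passing to cosyzygies
(`mapExt_bijective_of_ext_e_projective`). The `l`-side argument is dual, using the counit `l (e X) ⟶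
X`. Conversely, the four dimensions are bounded by transporting vanishing alone, so arbitrary
isomorphisms suffice (`dimensions_le_of_hasExtIsosAbove`). -/

/-! ### Long exact `Ext` sequences and comparison along an exact functor -/

section ExtLemmas

variable {ℬ : Type u₂} [Category.{v₂} ℬ] [Abelian ℬ]

lemma shortExact_kernel_factorThruImage {Y Y' : ℬ} (f : Y ⟶ Y') :
    (ShortComplex.mk (kernel.ι f) (Abelian.factorThruImage f)
      (by rw [← cancel_mono (Abelian.image.ι f)]; simp)).ShortExact where
  exact := ShortComplex.exact_of_f_is_kernel _
    (isKernelOfComp (Abelian.image.ι f) f (kernelIsKernel f) _ (by simp))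

lemma shortExact_image_cokernel {Y Y' : ℬ} (f : Y ⟶ Y') :
    (ShortComplex.mk (Abelian.image.ι f) (cokernel.π f) (kernel.condition _)).ShortExact where
  exact := ShortComplex.exact_of_f_is_kernel _ (kernelIsKernel (cokernel.π f))

variable [HasExt.{w₂} ℬ]
  {𝒞 : Type u₃} [Category.{v₃} 𝒞] [Abelian 𝒞] [HasExt.{w₃} 𝒞]

lemma Ext.postcomp_mk₀_bijective_of_isIso {X Y Y' : ℬ} (f : Y ⟶ Y') [IsIso f] (n : ℕ) :
    Function.Bijective ((Ext.mk₀ f).postcomp X (add_zero n)) := by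
  refine Function.bijective_iff_has_inverse.2
    ⟨(Ext.mk₀ (inv f)).postcomp X (add_zero n), fun x => ?_, fun x => ?_⟩
  all_goals simp

lemma Ext.precomp_mk₀_bijective_of_isIso {X X' Y : ℬ} (f : X ⟶ X') [IsIso f] (n : ℕ) :
    Function.Bijective ((Ext.mk₀ f).precomp Y (zero_add n)) := by
  refine Function.bijective_iff_has_inverse.2
    ⟨(Ext.mk₀ (inv f)).precomp Y (zero_add n), fun x => ?_, fun x => ?_⟩
  all_goals simp

lemma Ext.postcomp_mk₀_bijective_of_epi {X : ℬ} {S : ShortComplex ℬ} (hS : S.ShortExact) (n : ℕ)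
    [Subsingleton (Ext.{w₂} X S.X₁ n)] [Subsingleton (Ext.{w₂} X S.X₁ (n + 1))] :
    Function.Bijective ((Ext.mk₀ S.g).postcomp X (add_zero n) :
      Ext.{w₂} X S.X₂ n → Ext.{w₂} X S.X₃ n) := by
  refine ⟨(injective_iff_map_eq_zero _).2 fun x hx => ?_, fun x => ?_⟩
  · obtain ⟨y, rfl⟩ := Ext.covariant_sequence_exact₂ X hS x hx
    simp [Subsingleton.elim y 0]
  · exact Ext.covariant_sequence_exact₃ X hS x rfl (Subsingleton.elim _ _)

lemma Ext.postcomp_mk₀_bijective_of_mono {X : ℬ} {S : ShortComplex ℬ} (hS : S.ShortExact) (n : ℕ)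
    [Subsingleton (Ext.{w₂} X S.X₃ n)] [Subsingleton (Ext.{w₂} X S.X₃ (n + 1))] :
    Function.Bijective ((Ext.mk₀ S.f).postcomp X (add_zero (n + 1)) :
      Ext.{w₂} X S.X₁ (n + 1) → Ext.{w₂} X S.X₂ (n + 1)) := by
  refine ⟨(injective_iff_map_eq_zero _).2 fun x hx => ?_, fun x => ?_⟩
  · obtain ⟨y, rfl⟩ := Ext.covariant_sequence_exact₁ X hS x hx rfl
    simp [Subsingleton.elim y 0]
  · exact Ext.covariant_sequence_exact₂ X hS x (Subsingleton.elim _ _)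

lemma Ext.precomp_mk₀_bijective_of_mono {Y : ℬ} {S : ShortComplex ℬ} (hS : S.ShortExact) (n : ℕ)
    [Subsingleton (Ext.{w₂} S.X₃ Y n)] [Subsingleton (Ext.{w₂} S.X₃ Y (n + 1))] :
    Function.Bijective ((Ext.mk₀ S.f).precomp Y (zero_add n) :
      Ext.{w₂} S.X₂ Y n → Ext.{w₂} S.X₁ Y n) := by
  refine ⟨(injective_iff_map_eq_zero _).2 fun x hx => ?_, fun x => ?_⟩
  · obtain ⟨y, rfl⟩ := Ext.contravariant_sequence_exact₂ hS Y x hx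
    simp [Subsingleton.elim y 0]
  · exact Ext.contravariant_sequence_exact₁ hS Y x (add_comm 1 n) (Subsingleton.elim _ _)

lemma Ext.precomp_mk₀_bijective_of_epi {Y : ℬ} {S : ShortComplex ℬ} (hS : S.ShortExact) (n : ℕ)
    [Subsingleton (Ext.{w₂} S.X₁ Y n)] [Subsingleton (Ext.{w₂} S.X₁ Y (n + 1))] :
    Function.Bijective ((Ext.mk₀ S.g).precomp Y (zero_add (n + 1)) :
      Ext.{w₂} S.X₃ Y (n + 1) → Ext.{w₂} S.X₂ Y (n + 1)) := by
  refine ⟨(injective_iff_map_eq_zero _).2 fun x hx => ?_, fun x => ?_⟩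
  · obtain ⟨y, rfl⟩ := Ext.contravariant_sequence_exact₃ hS Y x hx (add_comm 1 n)
    simp [Subsingleton.elim y 0]
  · exact Ext.contravariant_sequence_exact₂ hS Y x (Subsingleton.elim _ _)

/-- A morphism whose kernel and cokernel have vanishing `Ext` groups from `X` around degree `n`
induces an isomorphism on `Ext X _`. -/
lemma Ext.postcomp_mk₀_bijective {X Y Y' : ℬ} (f : Y ⟶ Y') (n : ℕ)
    [Subsingleton (Ext.{w₂} X (kernel f) (n + 1))]
    [Subsingleton (Ext.{w₂} X (kernel f) (n + 1 + 1))]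
    [Subsingleton (Ext.{w₂} X (cokernel f) n)]
    [Subsingleton (Ext.{w₂} X (cokernel f) (n + 1))] :
    Function.Bijective ((Ext.mk₀ f).postcomp X (add_zero (n + 1)) :
      Ext.{w₂} X Y (n + 1) → Ext.{w₂} X Y' (n + 1)) := by
  -- The epi part of the image factorization has kernel `kernel f`; the mono part has cokernel
  -- `cokernel f`.
  have h := (Ext.postcomp_mk₀_bijective_of_mono (X := X) (shortExact_image_cokernel f) n).comp
    (Ext.postcomp_mk₀_bijective_of_epi (X := X) (shortExact_kernel_factorThruImage f) (n + 1))
  convert h using 1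
  ext x : 1
  simp

lemma Ext.precomp_mk₀_bijective {X X' Y : ℬ} (f : X ⟶ X') (n : ℕ)
    [Subsingleton (Ext.{w₂} (kernel f) Y n)]
    [Subsingleton (Ext.{w₂} (kernel f) Y (n + 1))]
    [Subsingleton (Ext.{w₂} (cokernel f) Y (n + 1))]
    [Subsingleton (Ext.{w₂} (cokernel f) Y (n + 1 + 1))] :
    Function.Bijective ((Ext.mk₀ f).precomp Y (zero_add (n + 1)) :
      Ext.{w₂} X' Y (n + 1) → Ext.{w₂} X Y (n + 1)) := by
  have h := (Ext.precomp_mk₀_bijective_of_epi (Y := Y) (shortExact_kernel_factorThruImage f)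
    n).comp (Ext.precomp_mk₀_bijective_of_mono (Y := Y) (shortExact_image_cokernel f) (n + 1))
  convert h using 1
  ext x : 1
  simp

variable (F : ℬ ⥤ 𝒞) [F.Additive] [PreservesFiniteLimits F] [PreservesFiniteColimits F]

/-- The map `Extⁿ(X, Y) → Extⁿ(F X, F Y)` is bijective for all `X`, `Y`, `n` where it is so after
replacing `Y` along `f`. -/
lemma mapExtAddHom_bijective_of_postcomp {X Y Y' : ℬ} (f : Y ⟶ Y') [IsIso (F.map f)] (n : ℕ)
    (hf : Function.Bijective ((Ext.mk₀ f).postcomp X (add_zero n) :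
      Ext.{w₂} X Y n → Ext.{w₂} X Y' n))
    (h : Function.Bijective (F.mapExtAddHom X Y' n : Ext.{w₂} X Y' n → Ext.{w₃} _ _ n)) :
    Function.Bijective (F.mapExtAddHom X Y n : Ext.{w₂} X Y n → Ext.{w₃} _ _ n) := by
  -- In the naturality square for `f`, composition with the invertible `F.map f` is bijective.
  refine (Function.Bijective.of_comp_iff' (Ext.postcomp_mk₀_bijective_of_isIso.{w₃}
    (X := F.obj X) (F.map f) n) _).1 ?_
  convert h.comp hf using 1
  ext x : 1
  simp [Ext.mapExactFunctor_comp, Ext.mapExactFunctor_mk₀]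

lemma mapExtAddHom_bijective_of_precomp {X X' Y : ℬ} (f : X ⟶ X') [IsIso (F.map f)] (n : ℕ)
    (hf : Function.Bijective ((Ext.mk₀ f).precomp Y (zero_add n) :
      Ext.{w₂} X' Y n → Ext.{w₂} X Y n))
    (h : Function.Bijective (F.mapExtAddHom X Y n : Ext.{w₂} X Y n → Ext.{w₃} _ _ n)) :
    Function.Bijective (F.mapExtAddHom X' Y n : Ext.{w₂} X' Y n → Ext.{w₃} _ _ n) := by
  refine (Function.Bijective.of_comp_iff' (Ext.precomp_mk₀_bijective_of_isIso.{w₃}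
    (Y := F.obj Y) (F.map f) n) _).1 ?_
  convert h.comp hf using 1
  ext x : 1
  simp [Ext.mapExactFunctor_comp, Ext.mapExactFunctor_mk₀]

/-- Vanishing in degree `n + 1` at `S.X₂` presents both groups at `S.X₁` as cokernels of maps in
degree `n`. Comparing these right exact rows needs only surjectivity at `S.X₂`. -/
lemma mapExtAddHom_bijective_succ_of_covariant {X : ℬ} {S : ShortComplex ℬ} (hS : S.ShortExact)
    (n : ℕ)
    (h₂ : Function.Surjective
      (F.mapExtAddHom X S.X₂ n : Ext.{w₂} X S.X₂ n → Ext.{w₃} _ _ n))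
    (h₃ : Function.Bijective
      (F.mapExtAddHom X S.X₃ n : Ext.{w₂} X S.X₃ n → Ext.{w₃} _ _ n))
    (hB : Subsingleton (Ext.{w₂} X S.X₂ (n + 1)))
    (hC : Subsingleton (Ext.{w₃} (F.obj X) (F.obj S.X₂) (n + 1))) :
    Function.Bijective
      (F.mapExtAddHom X S.X₁ (n + 1) : Ext.{w₂} X S.X₁ (n + 1) → Ext.{w₃} _ _ (n + 1)) := by
  have : Subsingleton (Ext.{w₃} (F.obj X) (S.map F).X₂ (n + 1)) := hC
  exact AddMonoidHom.bijective_of_surjective_of_bijective_of_right_exact _ _ _ _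
      (F.mapExtAddHom X S.X₂ n) (F.mapExtAddHom X S.X₃ n) (F.mapExtAddHom X S.X₁ (n + 1))
      (by ext; simp [Ext.mapExactFunctor_comp, Ext.mapExactFunctor_mk₀]; rfl)
      (by ext; simp [Ext.mapExactFunctor_comp, Ext.mapExactFunctor_extClass]; rfl)
      ((ShortComplex.ab_exact_iff_function_exact _).mp
        (Ext.covariant_sequence_exact₃' X hS n (n + 1) rfl))
      ((ShortComplex.ab_exact_iff_function_exact _).mp
        (Ext.covariant_sequence_exact₃' (F.obj X) (hS.map_of_exact F) n (n + 1) rfl))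
      h₂ h₃
      (fun x₁ ↦ Ext.covariant_sequence_exact₁ _ hS x₁ (Subsingleton.elim _ _) rfl)
      (fun y₁ ↦ Ext.covariant_sequence_exact₁ _ (hS.map_of_exact F) y₁ (Subsingleton.elim _ _) rfl)

lemma mapExtAddHom_bijective_succ_of_contravariant {Y : ℬ} {S : ShortComplex ℬ}
    (hS : S.ShortExact) (n : ℕ)
    (h₂ : Function.Surjective
      (F.mapExtAddHom S.X₂ Y n : Ext.{w₂} S.X₂ Y n → Ext.{w₃} _ _ n))
    (h₁ : Function.Bijective
      (F.mapExtAddHom S.X₁ Y n : Ext.{w₂} S.X₁ Y n → Ext.{w₃} _ _ n))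
    (hB : Subsingleton (Ext.{w₂} S.X₂ Y (n + 1)))
    (hC : Subsingleton (Ext.{w₃} (F.obj S.X₂) (F.obj Y) (n + 1))) :
    Function.Bijective
      (F.mapExtAddHom S.X₃ Y (n + 1) : Ext.{w₂} S.X₃ Y (n + 1) → Ext.{w₃} _ _ (n + 1)) := by
  have : Subsingleton (Ext.{w₃} (S.map F).X₂ (F.obj Y) (n + 1)) := hC
  exact AddMonoidHom.bijective_of_surjective_of_bijective_of_right_exact _ _ _ _
      (F.mapExtAddHom S.X₂ Y n) (F.mapExtAddHom S.X₁ Y n) (F.mapExtAddHom S.X₃ Y (n + 1))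
      (by ext; simp [Ext.mapExactFunctor_comp, Ext.mapExactFunctor_mk₀]; rfl)
      (by ext; simp [Ext.mapExactFunctor_comp, Ext.mapExactFunctor_extClass]; rfl)
      ((ShortComplex.ab_exact_iff_function_exact _).1
        (Ext.contravariant_sequence_exact₁' hS Y n (n + 1) (add_comm 1 n)))
      ((ShortComplex.ab_exact_iff_function_exact _).1
        (Ext.contravariant_sequence_exact₁' (hS.map_of_exact F) (F.obj Y) n (n + 1) (add_comm 1 n)))
      h₂ h₁
      (fun x₃ ↦ Ext.contravariant_sequence_exact₃ hS _ x₃ (Subsingleton.elim _ _) (add_comm 1 n))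
      (fun y₃ ↦ Ext.contravariant_sequence_exact₃ (hS.map_of_exact F) _ y₃ (Subsingleton.elim _ _)
        (add_comm 1 n))

end ExtLemmas

/-! ### Vanishing of `Ext` -/

section DimensionShift

variable {ℬ : Type u₂} [Category.{v₂} ℬ] [Abelian ℬ] [HasExt.{w₂} ℬ]

lemma Ext.subsingleton_of_covariant {X : ℬ} {S : ShortComplex ℬ} (hS : S.ShortExact) (n : ℕ)
    (h₂ : Subsingleton (Ext.{w₂} X S.X₂ n)) (h₁ : Subsingleton (Ext.{w₂} X S.X₁ (n + 1))) :
    Subsingleton (Ext.{w₂} X S.X₃ n) := by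
  refine subsingleton_of_forall_eq 0 fun x => ?_
  obtain ⟨y, rfl⟩ := Ext.covariant_sequence_exact₃ X hS x rfl (Subsingleton.elim _ _)
  simp [Subsingleton.elim y 0]

lemma Ext.subsingleton_of_contravariant {Y : ℬ} {S : ShortComplex ℬ} (hS : S.ShortExact) (n : ℕ)
    (h₂ : Subsingleton (Ext.{w₂} S.X₂ Y n)) (h₃ : Subsingleton (Ext.{w₂} S.X₃ Y (n + 1))) :
    Subsingleton (Ext.{w₂} S.X₁ Y n) := by
  refine subsingleton_of_forall_eq 0 fun x => ?_
  obtain ⟨y, rfl⟩ := Ext.contravariant_sequence_exact₁ hS Y x (add_comm 1 n)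
    (Subsingleton.elim _ _)
  simp [Subsingleton.elim y 0]

lemma Ext.subsingleton_of_iso_right {X Y Y' : ℬ} (f : Y ≅ Y') (n : ℕ)
    (h : Subsingleton (Ext.{w₂} X Y n)) : Subsingleton (Ext.{w₂} X Y' n) :=
  (Ext.postcomp_mk₀_bijective_of_isIso (X := X) f.hom n).surjective.subsingleton

lemma Ext.subsingleton_of_iso_left {X X' Y : ℬ} (f : X ≅ X') (n : ℕ)
    (h : Subsingleton (Ext.{w₂} X Y n)) : Subsingleton (Ext.{w₂} X' Y n) :=
  (Ext.precomp_mk₀_bijective_of_isIso (Y := Y) f.inv n).surjective.subsingleton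

lemma Ext.subsingleton_of_isZero_left {X Y : ℬ} (h : IsZero X) (n : ℕ) :
    Subsingleton (Ext.{w₂} X Y n) :=
  have := h.hasProjectiveDimensionLT_zero
  HasProjectiveDimensionLT.subsingleton X 0 n (Nat.zero_le _) Y

lemma Ext.subsingleton_of_isZero_right {X Y : ℬ} (h : IsZero Y) (n : ℕ) :
    Subsingleton (Ext.{w₂} X Y n) :=
  have := h.hasInjectiveDimensionLT_zero
  HasInjectiveDimensionLT.subsingleton Y 0 n (Nat.zero_le _) X

end DimensionShift

/-! ### Comparison of `Ext` under vanishing hypotheses -/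

namespace AbelianRecollement

variable {𝒜 : Type u₁} [Category.{v₁} 𝒜] [Abelian 𝒜]
  {ℬ : Type u₂} [Category.{v₂} ℬ] [Abelian ℬ]
  {𝒞 : Type u₃} [Category.{v₃} 𝒞] [Abelian 𝒞]
  (R : AbelianRecollement 𝒜 ℬ 𝒞)

lemma preservesLimits_r : PreservesLimits R.r := R.adj_er.rightAdjoint_preservesLimits

lemma preservesColimits_l : PreservesColimits R.l := R.adj_le.leftAdjoint_preservesColimits

instance preservesFiniteLimits_r : PreservesFiniteLimits R.r := by
  have := R.preservesLimits_r
  exact ⟨fun _ _ _ => inferInstance⟩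

instance preservesFiniteColimits_l : PreservesFiniteColimits R.l := by
  have := R.preservesColimits_l
  exact ⟨fun _ _ _ => inferInstance⟩

instance additive_r : R.r.Additive := Functor.additive_of_preserves_binary_products R.r

instance additive_l : R.l.Additive := by
  have := preservesBinaryBiproducts_of_preservesBinaryCoproducts R.l
  exact Functor.additive_of_preservesBinaryBiproducts R.l

instance isIso_counit_er : IsIso R.adj_er.counit := by
  have := R.r_fullyFaithful.full
  have := R.r_fullyFaithful.faithful
  exact R.adj_er.counit_isIso_of_R_fully_faithful

instance isIso_unit_le : IsIso R.adj_le.unit := by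
  have := R.l_fullyFaithful.full
  have := R.l_fullyFaithful.faithful
  exact R.adj_le.unit_isIso_of_L_fully_faithful

instance isIso_e_map_unit (Y : ℬ) : IsIso (R.e.map (R.adj_er.unit.app Y)) :=
  isIso_of_comp_hom_eq_id _ (R.adj_er.left_triangle_components Y)

instance isIso_e_map_counit (X : ℬ) : IsIso (R.e.map (R.adj_le.counit.app X)) :=
  isIso_of_hom_comp_eq_id _ (R.adj_le.right_triangle_components X)

/-- The isomorphism `e (r Z) ≅ Z`. -/
noncomputable def eR (Z : 𝒞) : R.e.obj (R.r.obj Z) ≅ Z := asIso (R.adj_er.counit.app Z)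

/-- The isomorphism `Z ≅ e (l Z)`. -/
noncomputable def eL (Z : 𝒞) : Z ≅ R.e.obj (R.l.obj Z) := asIso (R.adj_le.unit.app Z)

lemma projective_l (P : 𝒞) [Projective P] : Projective (R.l.obj P) :=
  R.adj_le.map_projective P inferInstance

lemma injective_r (J : 𝒞) [Injective J] : Injective (R.r.obj J) :=
  R.adj_er.map_injective J inferInstance

/-- Exactness of `e` turns this into the kernel of an isomorphism. It is applied to the unit of `e ⊣
r` and the counit of `l ⊣ e`. -/
lemma isZero_e_kernel {X Y : ℬ} (f : X ⟶ Y) [IsIso (R.e.map f)] :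
    IsZero (R.e.obj (kernel f)) :=
  (isZero_kernel_of_mono (R.e.map f)).of_iso (PreservesKernel.iso R.e f)

lemma isZero_e_cokernel {X Y : ℬ} (f : X ⟶ Y) [IsIso (R.e.map f)] :
    IsZero (R.e.obj (cokernel f)) :=
  (isZero_cokernel_of_epi (R.e.map f)).of_iso (PreservesCokernel.iso R.e f)

variable [HasExt.{w₃} 𝒞]

/-- `r` preserves the exactness of `0 ⟶ X₁ ⟶ X₂ ⟶ X₃ ⟶ 0` when `Ext¹(e P, X₁)` vanishes for
projective `P`. -/
lemma shortExact_map_r [EnoughProjectives ℬ] {S : ShortComplex 𝒞} (hS : S.ShortExact)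
    (h : ∀ P : ℬ, Projective P → Subsingleton (Ext.{w₃} (R.e.obj P) S.X₁ 1)) :
    (S.map R.r).ShortExact := by
  have := hS.mono_f
  -- The adjunct of a projective presentation of `r X₃` lifts along `S.g` because the `Ext¹`
  -- obstruction vanishes; transposing the lift factors the presentation through `r.map S.g`.
  have : Epi (R.r.map S.g) := by
    have := h _ (Projective.projective_over (R.r.obj S.X₃))
    let x := (R.adj_er.homEquiv _ _).symm (Projective.π (R.r.obj S.X₃))
    obtain ⟨y, hy⟩ := Ext.covariant_sequence_exact₃ _ hS (Ext.mk₀ x) (zero_add 1)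
      (Subsingleton.elim _ _)
    obtain ⟨y, rfl⟩ := (Ext.mk₀_bijective _ _).surjective y
    have hy' : y ≫ S.g = x := (Ext.mk₀_bijective _ _).injective (by simpa using hy)
    have : R.adj_er.homEquiv _ _ y ≫ R.r.map S.g = Projective.π (R.r.obj S.X₃) := by
      rw [← Adjunction.homEquiv_naturality_right, hy', Equiv.apply_symm_apply]
    exact epi_of_epi_fac this
  exact
    { exact := hS.exact.map_of_mono_of_preservesKernel R.r hS.mono_f inferInstance
      mono_f := inferInstanceAs (Mono (R.r.map S.f))
      epi_g := this }

/-- `l` preserves the exactness of `0 ⟶ X₁ ⟶ X₂ ⟶ X₃ ⟶ 0` when `Ext¹(X₃, e I)` vanishes for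
injective `I`. -/
lemma shortExact_map_l [EnoughInjectives ℬ] {S : ShortComplex 𝒞} (hS : S.ShortExact)
    (h : ∀ I : ℬ, Injective I → Subsingleton (Ext.{w₃} S.X₃ (R.e.obj I) 1)) :
    (S.map R.l).ShortExact := by
  have := hS.epi_g
  have : Mono (R.l.map S.f) := by
    have := h _ (Injective.injective_under (R.l.obj S.X₁))
    let x := R.adj_le.homEquiv _ _ (Injective.ι (R.l.obj S.X₁))
    obtain ⟨y, hy⟩ := Ext.contravariant_sequence_exact₁ hS _ (Ext.mk₀ x) (add_zero 1)
      (Subsingleton.elim _ _)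
    obtain ⟨y, rfl⟩ := (Ext.mk₀_bijective _ _).surjective y
    have hy' : S.f ≫ y = x := (Ext.mk₀_bijective _ _).injective (by simpa using hy)
    have : R.l.map S.f ≫ (R.adj_le.homEquiv _ _).symm y = Injective.ι (R.l.obj S.X₁) := by
      rw [← Adjunction.homEquiv_naturality_left_symm, hy', Equiv.symm_apply_apply]
    exact mono_of_mono_fac this
  exact
    { exact := hS.exact.map_of_epi_of_preservesCokernel R.l hS.epi_g inferInstance
      mono_f := this
      epi_g := inferInstanceAs (Epi (R.l.map S.g)) }

variable [HasExt.{w₂} ℬ]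

/-- The vanishing hypothesis both makes `r` exact on `0 ⟶ Z ⟶ J ⟶ J/Z ⟶ 0` and passes to the
cosyzygy `J/Z`, so dimension shifting reduces to degree zero. -/
lemma mapExt_bijective_r [EnoughProjectives ℬ] [EnoughInjectives 𝒞] (j : ℕ) (Z : 𝒞)
    (hZ : ∀ P : ℬ, Projective P → ∀ n, Subsingleton (Ext.{w₃} (R.e.obj P) Z (n + 1))) (X : ℬ) :
    Function.Bijective (R.e.mapExtAddHom X (R.r.obj Z) j :
      Ext.{w₂} X (R.r.obj Z) j → Ext.{w₃} _ _ j) := by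
  induction j generalizing Z with
  | zero =>
    suffices h : Function.Bijective (R.e.map (X := X) (Y := R.r.obj Z)) by
      simpa [Ext.mapExactFunctor₀] using h
    have h := (R.adj_er.homEquiv X Z).symm.bijective
    -- In degree zero, `e` on morphisms is the adjunction bijection up to `e (r Z) ≅ Z`.
    have h' : ((R.adj_er.homEquiv X Z).symm : _ → _) =
        (R.eR Z).homToEquiv (Z := R.e.obj X) ∘ (R.e.map (X := X) (Y := R.r.obj Z)) := by
      ext f
      simp [Adjunction.homEquiv_counit, eR]
    rw [h'] at h
    exact (Function.Bijective.of_comp_iff' (Equiv.bijective _) _).1 h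
  | succ j ih =>
    let J := Injective.under Z
    let S := ShortComplex.mk _ _ (cokernel.condition (Injective.ι Z))
    have hS : S.ShortExact := { exact := ShortComplex.exact_cokernel _ }
    have : Injective (R.r.obj J) := R.injective_r J
    have : Injective (R.e.obj (R.r.obj J)) := Injective.of_iso (R.eR J).symm inferInstance
    refine mapExtAddHom_bijective_succ_of_covariant R.e
      (R.shortExact_map_r hS fun P hP => hZ P hP 0) j
      (ih J fun P hP n => Ext.subsingleton_of_injective _ _ n).surjective
      (ih _ fun P hP n => ?_)
      (Ext.subsingleton_of_injective X (R.r.obj J) j)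
      (Ext.subsingleton_of_injective (R.e.obj X) (R.e.obj (R.r.obj J)) j)
    exact Ext.subsingleton_of_covariant hS (n + 1) (Ext.subsingleton_of_injective _ J n)
      (hZ P hP (n + 1))

lemma mapExt_bijective_l [EnoughInjectives ℬ] [EnoughProjectives 𝒞] (j : ℕ) (W : 𝒞)
    (hW : ∀ I : ℬ, Injective I → ∀ n, Subsingleton (Ext.{w₃} W (R.e.obj I) (n + 1))) (Y : ℬ) :
    Function.Bijective (R.e.mapExtAddHom (R.l.obj W) Y j :
      Ext.{w₂} (R.l.obj W) Y j → Ext.{w₃} _ _ j) := by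
  induction j generalizing W with
  | zero =>
    suffices h : Function.Bijective (R.e.map (X := R.l.obj W) (Y := Y)) by
      simpa [Ext.mapExactFunctor₀] using h
    have h := (R.adj_le.homEquiv W Y).bijective
    have h' : (R.adj_le.homEquiv W Y : _ → _) =
        (R.eL W).symm.homFromEquiv (Z := R.e.obj Y) ∘ (R.e.map (X := R.l.obj W) (Y := Y)) := by
      ext f
      simp [Adjunction.homEquiv_unit, eL]
    rw [h'] at h
    exact (Function.Bijective.of_comp_iff' (Equiv.bijective _) _).1 h
  | succ j ih =>
    let P := Projective.over W
    let S := ShortComplex.mk _ _ (kernel.condition (Projective.π W))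
    have hS : S.ShortExact := { exact := ShortComplex.exact_kernel _ }
    have : Projective (R.l.obj P) := R.projective_l P
    have : Projective (R.e.obj (R.l.obj P)) := Projective.of_iso (R.eL P) inferInstance
    refine mapExtAddHom_bijective_succ_of_contravariant R.e
      (R.shortExact_map_l hS fun I hI => hW I hI 0) j
      (ih P fun I hI n => Ext.subsingleton_of_projective _ _ n).surjective
      (ih _ fun I hI n => ?_)
      (Ext.subsingleton_of_projective (R.l.obj P) Y j)
      (Ext.subsingleton_of_projective (R.e.obj (R.l.obj P)) (R.e.obj Y) j)
    exact Ext.subsingleton_of_contravariant hS (n + 1) (Ext.subsingleton_of_projective P _ n)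
      (hW I hI (n + 1))

/-- Each cosyzygy lowers both `k` and `j` by one. The extra `1` in the bound comes from the cokernel
of the unit, whose `Ext` must also vanish in degree `j - 1`. -/
theorem mapExt_bijective_of_ext_e_projective [EnoughProjectives ℬ] [EnoughInjectives 𝒞] {m : ℕ}
    (hm : ∀ K : ℬ, IsZero (R.e.obj K) → ∀ X j, m < j → Subsingleton (Ext.{w₂} X K j)) (k : ℕ)
    (Y : ℬ) (hY : ∀ P : ℬ, Projective P → ∀ j, k < j →
      Subsingleton (Ext.{w₃} (R.e.obj P) (R.e.obj Y) j)) (X : ℬ) (j : ℕ) (hj : m + k + 1 < j) :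
    Function.Bijective (R.e.mapExtAddHom X Y j : Ext.{w₂} X Y j → Ext.{w₃} _ _ j) := by
  induction k generalizing Y j with
  | zero =>
    obtain ⟨j, rfl⟩ := Nat.exists_eq_succ_of_ne_zero (show j ≠ 0 by lia)
    let η := R.adj_er.unit.app Y
    have hk := hm _ (R.isZero_e_kernel η) X
    have hc := hm _ (R.isZero_e_cokernel η) X
    have := hk (j + 1) (by lia)
    have := hk (j + 1 + 1) (by lia)
    have := hc j (by lia)
    have := hc (j + 1) (by lia)
    exact mapExtAddHom_bijective_of_postcomp R.e η _ (Ext.postcomp_mk₀_bijective η j)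
      (R.mapExt_bijective_r _ _ (fun P hP n => hY P hP (n + 1) (Nat.succ_pos n)) X)
  | succ k ih =>
    obtain ⟨j, rfl⟩ := Nat.exists_eq_succ_of_ne_zero (show j ≠ 0 by lia)
    obtain ⟨i, rfl⟩ := Nat.exists_eq_succ_of_ne_zero (show j ≠ 0 by lia)
    let η := R.adj_er.unit.app Y
    have hk := hm _ (R.isZero_e_kernel η) X
    have hc := hm _ (R.isZero_e_cokernel η) X
    have := hk (i + 1 + 1) (by lia)
    have := hk (i + 1 + 1 + 1) (by lia)
    have := hc (i + 1) (by lia)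
    have := hc (i + 1 + 1) (by lia)
    refine mapExtAddHom_bijective_of_postcomp R.e η _ (Ext.postcomp_mk₀_bijective η (i + 1)) ?_
    let J := Injective.under (R.e.obj Y)
    have : Injective (R.r.obj J) := R.injective_r J
    have : Injective (R.e.obj (R.r.obj J)) := Injective.of_iso (R.eR J).symm inferInstance
    -- The cokernel is formed in `ℬ`, so exactness of `r` on the right is not needed; `e` still
    -- sends it to a cosyzygy of `e Y`.
    let S := ShortComplex.mk _ _ (cokernel.condition (R.r.map (Injective.ι (R.e.obj Y))))
    have hS : S.ShortExact := { exact := ShortComplex.exact_cokernel _ }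
    refine mapExtAddHom_bijective_succ_of_covariant R.e hS (i + 1) ?_
      (ih _ (fun P hP a ha => ?_) (i + 1) (by lia))
      (Ext.subsingleton_of_injective X (R.r.obj J) (i + 1))
      (Ext.subsingleton_of_injective (R.e.obj X) (R.e.obj (R.r.obj J)) (i + 1))
    -- Surjectivity is automatic: the target is zero in the positive degree `i + 1`.
    · have := Ext.subsingleton_of_injective.{w₃} (R.e.obj X) (R.e.obj (R.r.obj J)) i
      exact fun y => ⟨0, Subsingleton.elim (α := Ext.{w₃} (R.e.obj X) (R.e.obj (R.r.obj J)) (i + 1))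
        _ _⟩
    · obtain ⟨b, rfl⟩ := Nat.exists_eq_succ_of_ne_zero (show a ≠ 0 by lia)
      exact Ext.subsingleton_of_covariant (hS.map_of_exact R.e) (b + 1)
        (Ext.subsingleton_of_injective (R.e.obj P) (R.e.obj (R.r.obj J)) b)
        (Ext.subsingleton_of_iso_right (R.eR _).symm _ (hY P hP (b + 1 + 1) (by lia)))

theorem mapExt_bijective_of_ext_e_injective [EnoughInjectives ℬ] [EnoughProjectives 𝒞] {m : ℕ}
    (hm : ∀ K : ℬ, IsZero (R.e.obj K) → ∀ Y j, m < j → Subsingleton (Ext.{w₂} K Y j)) (k : ℕ)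
    (X : ℬ) (hX : ∀ I : ℬ, Injective I → ∀ j, k < j →
      Subsingleton (Ext.{w₃} (R.e.obj X) (R.e.obj I) j)) (Y : ℬ) (j : ℕ) (hj : m + k + 1 < j) :
    Function.Bijective (R.e.mapExtAddHom X Y j : Ext.{w₂} X Y j → Ext.{w₃} _ _ j) := by
  induction k generalizing X j with
  | zero =>
    obtain ⟨j, rfl⟩ := Nat.exists_eq_succ_of_ne_zero (show j ≠ 0 by lia)
    let ε := R.adj_le.counit.app X
    have hk := fun j => hm _ (R.isZero_e_kernel ε) Y j
    have hc := fun j => hm _ (R.isZero_e_cokernel ε) Y j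
    have := hk j (by lia)
    have := hk (j + 1) (by lia)
    have := hc (j + 1) (by lia)
    have := hc (j + 1 + 1) (by lia)
    exact mapExtAddHom_bijective_of_precomp R.e ε _ (Ext.precomp_mk₀_bijective ε j)
      (R.mapExt_bijective_l _ _ (fun I hI n => hX I hI (n + 1) (Nat.succ_pos n)) Y)
  | succ k ih =>
    obtain ⟨j, rfl⟩ := Nat.exists_eq_succ_of_ne_zero (show j ≠ 0 by lia)
    obtain ⟨i, rfl⟩ := Nat.exists_eq_succ_of_ne_zero (show j ≠ 0 by lia)
    let ε := R.adj_le.counit.app X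
    have hk := fun j => hm _ (R.isZero_e_kernel ε) Y j
    have hc := fun j => hm _ (R.isZero_e_cokernel ε) Y j
    have := hk (i + 1) (by lia)
    have := hk (i + 1 + 1) (by lia)
    have := hc (i + 1 + 1) (by lia)
    have := hc (i + 1 + 1 + 1) (by lia)
    refine mapExtAddHom_bijective_of_precomp R.e ε _ (Ext.precomp_mk₀_bijective ε (i + 1)) ?_
    let P := Projective.over (R.e.obj X)
    have : Projective (R.l.obj P) := R.projective_l P
    have : Projective (R.e.obj (R.l.obj P)) := Projective.of_iso (R.eL P) inferInstance
    let S := ShortComplex.mk _ _ (kernel.condition (R.l.map (Projective.π (R.e.obj X))))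
    have hS : S.ShortExact := { exact := ShortComplex.exact_kernel _ }
    refine mapExtAddHom_bijective_succ_of_contravariant R.e hS (i + 1) ?_
      (ih _ (fun I hI a ha => ?_) (i + 1) (by lia))
      (Ext.subsingleton_of_projective (R.l.obj P) Y (i + 1))
      (Ext.subsingleton_of_projective (R.e.obj (R.l.obj P)) (R.e.obj Y) (i + 1))
    · have := Ext.subsingleton_of_projective.{w₃} (R.e.obj (R.l.obj P)) (R.e.obj Y) i
      exact fun y => ⟨0, Subsingleton.elim (α := Ext.{w₃} (R.e.obj (R.l.obj P)) (R.e.obj Y) (i + 1))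
        _ _⟩
    · obtain ⟨b, rfl⟩ := Nat.exists_eq_succ_of_ne_zero (show a ≠ 0 by lia)
      exact Ext.subsingleton_of_contravariant (hS.map_of_exact R.e) (b + 1)
        (Ext.subsingleton_of_projective (R.e.obj (R.l.obj P)) (R.e.obj I) b)
        (Ext.subsingleton_of_iso_left (R.eL _) _ (hX I hI (b + 1 + 1) (by lia)))

end AbelianRecollement

/-! ### Dimensions in terms of `Ext` -/

section Dimension

variable {ℬ : Type u₂} [Category.{v₂} ℬ] [Abelian ℬ]

/-- Replacing the value `⊥` at zero objects by `0` does not affect upper bounds by natural numbers.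
-/
lemma projDim_le_iff (X : ℬ) (n : ℕ) : projDim X ≤ n ↔ HasProjectiveDimensionLE X n := by
  rw [← projectiveDimension_le_iff, projDim, WithBot.unbotD_le_iff (fun _ => zero_le)]
  rfl

lemma injDim_le_iff (X : ℬ) (n : ℕ) : injDim X ≤ n ↔ HasInjectiveDimensionLE X n := by
  rw [← injectiveDimension_le_iff, injDim, WithBot.unbotD_le_iff (fun _ => zero_le)]
  rfl

lemma projDim_le_iff_subsingleton_ext [HasExt.{w₂} ℬ] (X : ℬ) (n : ℕ) :
    projDim X ≤ n ↔ ∀ Y j, n < j → Subsingleton (Ext.{w₂} X Y j) := by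
  rw [projDim_le_iff]
  refine ⟨fun h Y j hj => h.subsingleton X (n + 1) j hj Y, fun h => ?_⟩
  exact HasProjectiveDimensionLT.mk fun i hi Y e => (h Y i hi).elim _ _

lemma injDim_le_iff_subsingleton_ext [HasExt.{w₂} ℬ] (Y : ℬ) (n : ℕ) :
    injDim Y ≤ n ↔ ∀ X j, n < j → Subsingleton (Ext.{w₂} X Y j) := by
  rw [injDim_le_iff]
  refine ⟨fun h X j hj => h.subsingleton Y (n + 1) j hj X, fun h => ?_⟩
  exact HasInjectiveDimensionLT.mk fun i hi X e => (h X i hi).elim _ _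

end Dimension

/-! ### Bounds relating the four dimensions to the comparison maps -/

namespace AbelianRecollement

variable {𝒜 : Type u₁} [Category.{v₁} 𝒜] [Abelian 𝒜]
  {ℬ : Type u₂} [Category.{v₂} ℬ] [Abelian ℬ]
  {𝒞 : Type u₃} [Category.{v₃} 𝒞] [Abelian 𝒞]
  (R : AbelianRecollement 𝒜 ℬ 𝒞)

lemma isZero_e_i (A : 𝒜) : IsZero (R.e.obj (R.i.obj A)) :=
  (R.essImage_i_iff _).1 (R.i.obj_mem_essImage A)

variable [HasExt.{w₂} ℬ] [HasExt.{w₃} 𝒞]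

lemma mapExt_bijective_of_igld_supPdProj [EnoughProjectives ℬ] [EnoughInjectives 𝒞] (X Y : ℬ)
    (j : ℕ) (hj : R.igld + R.supPdProj + 1 < (j : ℕ∞)) :
    Function.Bijective (R.e.mapExtAddHom X Y j : Ext.{w₂} X Y j → Ext.{w₃} _ _ j) := by
  -- The strict bound by a natural number already forces both suprema to be finite.
  have hi : R.igld ≠ ⊤ := fun h => by simp [h] at hj
  have hp : R.supPdProj ≠ ⊤ := fun h => by simp [h] at hj
  obtain ⟨m, hm⟩ := ENat.ne_top_iff_exists.1 hi
  obtain ⟨k, hk⟩ := ENat.ne_top_iff_exists.1 hp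
  rw [← hm, ← hk] at hj
  refine R.mapExt_bijective_of_ext_e_projective (m := m) (fun K hK X j hj => ?_) k Y
    (fun P hP j hj => ?_) X j (by exact_mod_cast hj)
  · obtain ⟨A, ⟨f⟩⟩ := (R.essImage_i_iff K).2 hK
    exact Ext.subsingleton_of_iso_right f _ ((injDim_le_iff_subsingleton_ext _ m).1
      ((le_iSup (fun A => injDim (R.i.obj A)) A).trans hm.ge) X j hj)
  · exact (projDim_le_iff_subsingleton_ext _ k).1
      ((le_iSup₂ (f := fun P (_ : Projective P) => projDim (R.e.obj P)) P hP).trans hk.ge) _ j hj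

lemma mapExt_bijective_of_pgld_supIdInj [EnoughInjectives ℬ] [EnoughProjectives 𝒞] (X Y : ℬ)
    (j : ℕ) (hj : R.pgld + R.supIdInj + 1 < (j : ℕ∞)) :
    Function.Bijective (R.e.mapExtAddHom X Y j : Ext.{w₂} X Y j → Ext.{w₃} _ _ j) := by
  have hi : R.pgld ≠ ⊤ := fun h => by simp [h] at hj
  have hp : R.supIdInj ≠ ⊤ := fun h => by simp [h] at hj
  obtain ⟨m, hm⟩ := ENat.ne_top_iff_exists.1 hi
  obtain ⟨k, hk⟩ := ENat.ne_top_iff_exists.1 hp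
  rw [← hm, ← hk] at hj
  refine R.mapExt_bijective_of_ext_e_injective (m := m) (fun K hK Y j hj => ?_) k X
    (fun I hI j hj => ?_) Y j (by exact_mod_cast hj)
  · obtain ⟨A, ⟨f⟩⟩ := (R.essImage_i_iff K).2 hK
    exact Ext.subsingleton_of_iso_left f _ ((projDim_le_iff_subsingleton_ext _ m).1
      ((le_iSup (fun A => projDim (R.i.obj A)) A).trans hm.ge) Y j hj)
  · exact (injDim_le_iff_subsingleton_ext _ k).1
      ((le_iSup₂ (f := fun I (_ : Injective I) => injDim (R.e.obj I)) I hI).trans hk.ge) _ j hj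

/-- `e` kills `i A`, which gives vanishing in `ℬ`. Since every `Z` is both `e (r Z)` and `e (l Z)`
up to isomorphism, vanishing for projective or injective objects of `ℬ` gives vanishing against all
of `𝒞`. -/
lemma dimensions_le_of_hasExtIsosAbove {t : ℕ} (h : HasExtIsosAbove.{w₂, w₃} R.e t) :
    R.igld ≤ t ∧ R.supPdProj ≤ t ∧ R.pgld ≤ t ∧ R.supIdInj ≤ t := by
  refine ⟨iSup_le fun A => ?_, iSup₂_le fun P hP => ?_, iSup_le fun A => ?_,
    iSup₂_le fun I hI => ?_⟩
  · refine (injDim_le_iff_subsingleton_ext.{w₂} _ t).2 fun X j hj => ?_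
    have := Ext.subsingleton_of_isZero_right.{w₃} (X := R.e.obj X) (R.isZero_e_i A) j
    exact (h j hj _ _).some.injective.subsingleton
  · refine (projDim_le_iff_subsingleton_ext.{w₃} _ t).2 fun Z j hj => ?_
    obtain ⟨j, rfl⟩ := Nat.exists_eq_succ_of_ne_zero (show j ≠ 0 by lia)
    have := Ext.subsingleton_of_projective.{w₂} P (R.r.obj Z) j
    exact Ext.subsingleton_of_iso_right (R.eR Z) _ (h _ hj P _).some.surjective.subsingleton
  · refine (projDim_le_iff_subsingleton_ext.{w₂} _ t).2 fun X j hj => ?_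
    have := Ext.subsingleton_of_isZero_left.{w₃} (Y := R.e.obj X) (R.isZero_e_i A) j
    exact (h j hj _ _).some.injective.subsingleton
  · refine (injDim_le_iff_subsingleton_ext.{w₃} _ t).2 fun Z j hj => ?_
    obtain ⟨j, rfl⟩ := Nat.exists_eq_succ_of_ne_zero (show j ≠ 0 by lia)
    have := Ext.subsingleton_of_injective.{w₂} (R.l.obj Z) I j
    exact Ext.subsingleton_of_iso_left (R.eL Z).symm _
      (h _ hj _ I).some.surjective.subsingleton

end AbelianRecollement

/-! ### The equivalences -/

theorem mainTheorem7
    {𝒜 : Type u₁} [Category.{v₁} 𝒜] [Abelian 𝒜]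
    {ℬ : Type u₂} [Category.{v₂} ℬ] [Abelian ℬ] [HasExt.{w₂} ℬ]
    [EnoughProjectives ℬ] [EnoughInjectives ℬ]
    {𝒞 : Type u₃} [Category.{v₃} 𝒞] [Abelian 𝒞] [HasExt.{w₃} 𝒞]
    [EnoughProjectives 𝒞] [EnoughInjectives 𝒞]
    (R : AbelianRecollement 𝒜 ℬ 𝒞)
    (h𝒜 : IsFiniteLengthCategory 𝒜) (hℬ : HasProjectiveCovers ℬ) :
    List.TFAE [
      ∃ t : ℤ, ∀ (X Y : ℬ) (j : ℕ), t < (j : ℤ) →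
        Function.Bijective
          (R.e.mapExtAddHom X Y j : Ext.{w₂} X Y j → Ext.{w₃} (R.e.obj X) (R.e.obj Y) j),
      IsEventuallyHomologicalIso.{w₂, w₃} R.e,
      R.igld < ⊤ ∧ R.supPdProj < ⊤,
      R.pgld < ⊤ ∧ R.supIdInj < ⊤] ∧
    (∀ s : ℕ, IsEventuallyHomologicalIsoOfDegree.{w₂, w₃} R.e s →
      R.igld ≤ s ∧ R.supPdProj ≤ s ∧ R.pgld ≤ s ∧ R.supIdInj ≤ s) ∧
    (∀ (X Y : ℬ) (j : ℕ), R.igld + R.supPdProj + 1 < (j : ℕ∞) →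
      Function.Bijective
        (R.e.mapExtAddHom X Y j : Ext.{w₂} X Y j → Ext.{w₃} (R.e.obj X) (R.e.obj Y) j)) ∧
    (∀ (X Y : ℬ) (j : ℕ), R.pgld + R.supIdInj + 1 < (j : ℕ∞) →
      Function.Bijective
        (R.e.mapExtAddHom X Y j : Ext.{w₂} X Y j → Ext.{w₃} (R.e.obj X) (R.e.obj Y) j)) := by
  have h31 := R.mapExt_bijective_of_igld_supPdProj.{w₂, w₃}
  have h41 := R.mapExt_bijective_of_pgld_supIdInj.{w₂, w₃}
  have of_bound (N : ℕ∞) (hN : N < ⊤) (h : ∀ (X Y : ℬ) (j : ℕ), N < (j : ℕ∞) →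
      Function.Bijective
        (R.e.mapExtAddHom X Y j : Ext.{w₂} X Y j → Ext.{w₃} (R.e.obj X) (R.e.obj Y) j)) :
      ∃ t : ℤ, ∀ (X Y : ℬ) (j : ℕ), t < (j : ℤ) →
        Function.Bijective
          (R.e.mapExtAddHom X Y j : Ext.{w₂} X Y j → Ext.{w₃} (R.e.obj X) (R.e.obj Y) j) := by
    lift N to ℕ using hN.ne
    exact ⟨N, fun X Y j hj => h X Y j (by exact_mod_cast hj)⟩
  refine ⟨?_, fun s hs => R.dimensions_le_of_hasExtIsosAbove hs.1.2, h31, h41⟩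
  tfae_have 1 → 2
  -- The integer `t` may be negative or zero, whereas the threshold in (2) must be positive.
  | ⟨t, ht⟩ => ⟨t.toNat + 1, Nat.succ_pos _, fun n hn X Y =>
      ⟨AddEquiv.ofBijective _ (ht X Y n (by lia))⟩⟩
  tfae_have 2 → 3
  | ⟨t, _, ht⟩ =>
    have h := R.dimensions_le_of_hasExtIsosAbove ht
    ⟨h.1.trans_lt (ENat.natCast_lt_top t), h.2.1.trans_lt (ENat.natCast_lt_top t)⟩
  tfae_have 2 → 4
  | ⟨t, _, ht⟩ =>
    have h := R.dimensions_le_of_hasExtIsosAbove ht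
    ⟨h.2.2.1.trans_lt (ENat.natCast_lt_top t), h.2.2.2.trans_lt (ENat.natCast_lt_top t)⟩
  tfae_have 3 → 1
  | h => of_bound _ (by simpa [WithTop.add_lt_top] using h) h31
  tfae_have 4 → 1
  | h => of_bound _ (by simpa [WithTop.add_lt_top] using h) h41
  tfae_finish
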